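/- Let $\mathbb{C}^+=\{z:\operatorname{Im}z>0\}$ and let $H^2(\mathbb{C}^+)$ be the Hardy space of holomorphic $F$ on $\mathbb{C}^+$ with $\|F\|^2=\sup_{y>0}\int_{\mathbb{R}}|F(x+iy)|^2\,dx<\infty$. Let $K(z,w)=\frac{i}{2\pi}\frac{1}{z-\bar w}$ be its Szegő kernel. Let $z_1,\dots,z_N\in\mathbb{C}^+$, let $A_1,\dots,A_N\in\mathbb{R}$ and $\lambda_1,\dots,\lambda_N>0$. For $\lambda>0$ define kernels by $K^{(0)}_\lambda=\frac1\lambda K$ and, for $1\le n\le N$, $$K^{(n)}_\lambda(z,w)=K^{(n-1)}_\lambda(z,w)-\frac{\lambda_n\operatorname{Re}K^{(n-1)}_\lambda(z_n,w)\,\operatorname{Re}K^{(n-1)}_\lambda(z,z_n)}{\lambda_n\operatorname{Re}K^{(n-1)}_\lambda(z_n,z_n)+1}.$$ Let $S^{(n)}$ be the $N\times N$ matrix that differs from the identity only in column $n$, with $$S^{(n)}_{in}=\delta_{in}-\frac{\lambda_n\operatorname{Re}K^{(n-1)}_\lambda(z_n,z_i)}{\lambda_n\operatorname{Re}K^{(n-1)}_\lambda(z_n,z_n)+1}.$$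 Put $(c_1,\dots,c_N)=(\lambda_1A_1,\dots,\lambda_NA_N)\,S^{(N)}\cdots S^{(1)}\,\frac1\lambda$ and $$F_{\{A_j,z_j\},\lambda}(z)=\sum_{j=1}^N c_j\operatorname{Re}K(z,z_j),\qquad z\in\mathbb{C}^+.$$ 1. For every $\lambda>0$ one has $F_{\{A_j,z_j\},\lambda}(z)=\sum_{j=1}^N A_j\lambda_j\operatorname{Re}K^{(N)}_\lambda(z,z_j)$ for $z\in\mathbb{C}^+$. The functional $$F\mapsto\lambda\|F\|^2+\sum_{j=1}^N\lambda_j|\operatorname{Re}F(z_j)-A_j|^2$$ has exactly one minimizer in $H^2(\mathbb{C}^+)$, namely $F_\lambda=\sum_{j=1}^N c_jK(\cdot,z_j)$, and $F_{\{A_j,z_j\},\lambda}=\operatorname{Re}F_\lambda$. 2. There is exactly one Moore–Penrose generalized-inverse solution $F^*\in H^2(\mathbb{C}^+)$ of the equations $\operatorname{Re}F(z_j)=A_j$ $(1\le j\le N)$, that is, an element of smallest norm among the minimizers of $\sum_{j}\lambda_j|\operatorname{Re}F(z_j)-A_j|^2$ over $H^2(\mathbb{C}^+)$. As $\lambda\to0^+$,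 $F_\lambda\to F^*$ in $H^2(\mathbb{C}^+)$, and $F_{\{A_j,z_j\},\lambda}(z)\to\operatorname{Re}F^*(z)$ for every $z\in\mathbb{C}^+$, uniformly on each $E_0\subseteq\mathbb{C}^+$ with $\sup_{p\in E_0}K(p,p)<\infty$. The function $u=\operatorname{Re}F^*$ is harmonic on $\mathbb{C}^+$. If the data are consistent ($A_i=A_j$ whenever $z_i=z_j$; in particular if the points are distinct), then $u(z_j)=A_j$ for $j=1,\dots,N$. -/

import Mathlib

open Filter Topology MeasureTheory
open scoped UpperHalfPlane ENNReal Matrix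

noncomputable section

namespace HardyDirichlet

/-- The (extended) Hardy norm of a function on the upper half-plane:
`sup_{y > 0} (∫_ℝ |F(x + iy)|² dx)^{1/2}`. -/
def hardyENorm (F : ℍ → ℂ) : ℝ≥0∞ :=
  ⨆ y : {y : ℝ // 0 < y}, eLpNorm (fun x : ℝ => F ⟨⟨x, y.1⟩, y.2⟩) 2 volume

/-- Membership in the Hardy space `H²(ℂ⁺)`: holomorphic on the upper half-plane,
with finite Hardy norm. -/
def MemHardy (F : ℍ → ℂ) : Prop :=
  DifferentiableOn ℂ (fun w : ℂ => F (UpperHalfPlane.ofComplex w)) {w : ℂ | 0 < w.im} ∧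
    hardyENorm F < ∞

/-- The norm of `H²(ℂ⁺)`. -/
def hardyNorm (F : ℍ → ℂ) : ℝ := (hardyENorm F).toReal

/-- The Szegő kernel `K(z, w) = (i / 2π) · 1 / (z - conj w)` of the upper half-plane. -/
def szego (z w : ℍ) : ℂ :=
  Complex.I / (2 * (Real.pi : ℂ)) * (1 / ((z : ℂ) - (starRingEnd ℂ) (w : ℂ)))

/-- The rank-one update of a kernel when the point `p` is added with weight `l`:
`k(z, w) - l Re k(p, w) Re k(z, p) / (l Re k(p, p) + 1)`. -/
def kernelUpdate (k : ℍ → ℍ → ℂ) (p : ℍ) (l : ℝ) (z w : ℍ) : ℂ :=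
  k z w - ((l * (k p w).re * (k z p).re / (l * (k p p).re + 1) : ℝ) : ℂ)

/-- The iterated kernels `K_lam^{(n)}`, `n = 0, …, N`: start from `K / lam` and add the points
`z_1, …, z_N` one after the other. -/
def iterKernel {N : ℕ} (z : Fin N → ℍ) (l : Fin N → ℝ) (lam : ℝ) :
    Fin (N + 1) → ℍ → ℍ → ℂ :=
  Fin.induction (motive := fun _ => ℍ → ℍ → ℂ) (fun p q => ((1 / lam : ℝ) : ℂ) * szego p q)
    (fun n k => kernelUpdate k (z n) (l n))

/-- The matrix `I - [0 | aᵀ | 0]`, with `aᵀ` in column `n` and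
`a_i = l_n Re k(z_n, z_i) / (l_n Re k(z_n, z_n) + 1)`, that takes the vector of the `Re k(·, z_i)`
to the vector of the real parts of the kernel updated at `z_n`. -/
def stepMatrix {N : ℕ} (z : Fin N → ℍ) (l : Fin N → ℝ) (k : ℍ → ℍ → ℂ) (n : Fin N) :
    Matrix (Fin N) (Fin N) ℝ :=
  1 - Matrix.of fun i m =>
    if m = n then l n * (k (z n) (z i)).re / (l n * (k (z n) (z n)).re + 1) else 0

/-- The products `A^{(n)} ⋯ A^{(1)}`, `n = 0, …, N`; the factor `1 / lam` of the first step is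
the value at `n = 0`. -/
def coefMatrix {N : ℕ} (z : Fin N → ℍ) (l : Fin N → ℝ) (lam : ℝ) :
    Fin (N + 1) → Matrix (Fin N) (Fin N) ℝ :=
  Fin.induction (motive := fun _ => Matrix (Fin N) (Fin N) ℝ) ((1 / lam) • 1)
    (fun n M => stepMatrix z l (iterKernel z l lam n.castSucc) n * M)

/-- The coefficients `c = (l_1 A_1, …, l_N A_N) (A^{(N)} ⋯ A^{(1)})`. -/
def coef {N : ℕ} (z : Fin N → ℍ) (A l : Fin N → ℝ) (lam : ℝ) : Fin N → ℝ :=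
  (fun j => l j * A j) ᵥ* coefMatrix z l lam (Fin.last N)

/-- The function `F_{{A_j, z_j}, lam}(w) = ∑ c_j Re K(w, z_j)` given by the algorithm. -/
def approxSolution {N : ℕ} (z : Fin N → ℍ) (A l : Fin N → ℝ) (lam : ℝ) (w : ℍ) : ℝ :=
  ∑ j, coef z A l lam j * (szego w (z j)).re

/-- The holomorphic function `∑ c_j K(w, z_j)` with the same coefficients. -/
def approxAnalytic {N : ℕ} (z : Fin N → ℍ) (A l : Fin N → ℝ) (lam : ℝ) (w : ℍ) : ℂ :=
  ∑ j, (coef z A l lam j : ℂ) * szego w (z j)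

/-- The weighted discrete residual `∑ l_j |Re F(z_j) - A_j|²`. -/
def residual {N : ℕ} (z : Fin N → ℍ) (A l : Fin N → ℝ) (F : ℍ → ℂ) : ℝ :=
  ∑ j, l j * |(F (z j)).re - A j| ^ 2

/-- The Tikhonov functional `lam ‖F‖² + ∑ l_j |Re F(z_j) - A_j|²`. -/
def tikhonov {N : ℕ} (z : Fin N → ℍ) (A l : Fin N → ℝ) (lam : ℝ) (F : ℍ → ℂ) : ℝ :=
  lam * hardyNorm F ^ 2 + residual z A l F

/-- `F` solves the Tikhonov-regularized extremal problem in `H²(ℂ⁺)`. -/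
def IsExtremal {N : ℕ} (z : Fin N → ℍ) (A l : Fin N → ℝ) (lam : ℝ) (F : ℍ → ℂ) : Prop :=
  MemHardy F ∧ ∀ G, MemHardy G → tikhonov z A l lam F ≤ tikhonov z A l lam G

/-- `F` is a least-squares solution in `H²(ℂ⁺)` of `Re F(z_j) = A_j`. -/
def IsLeastSquares {N : ℕ} (z : Fin N → ℍ) (A l : Fin N → ℝ) (F : ℍ → ℂ) : Prop :=
  MemHardy F ∧ ∀ G, MemHardy G → residual z A l F ≤ residual z A l G

/-- `F` is the Moore–Penrose generalized-inverse solution of `Re F(z_j) = A_j`: a least-squares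
solution of minimal norm among all of them. -/
def IsMoorePenrose {N : ℕ} (z : Fin N → ℍ) (A l : Fin N → ℝ) (F : ℍ → ℂ) : Prop :=
  IsLeastSquares z A l F ∧ ∀ G, IsLeastSquares z A l G → hardyNorm F ≤ hardyNorm G

end HardyDirichlet

end

/-!
Three-lines convexity makes the `L²` norm of a Hardy function on `Im w = y` antitone in `y`, so the
Hardy norm is a limit of `L²` norms as `y → 0⁺`, hence satisfies the parallelogram law. If `F`
vanishes at `w + 2iy`, the product `F · conj K(·, w)` is, on the line `Im = y`, a multiple of the
divided difference of `F` at that point, whose integral over the line can be moved off to `Im = ∞`;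
this gives the reproducing property of the Szegő kernel. The real equations `Re F(z_j) = A_j` become
`⟪K(·, z_j), F⟫ = A_j` in a real inner product space. With
`S F = ∑ l_j ⟪K(·, z_j), F⟫ K(·, z_j)`, the algorithm solves the normal equation
`(lam + S) F = ∑ l_j A_j K(·, z_j)` by adding one point at a time through the Sherman–Morrison
formula. The Moore–Penrose solution is the solution of `S F = ∑ l_j A_j K(·, z_j)` in the span of
the kernel functions. Products of Blaschke factors interpolate consistent data, so its residual is
then zero.
-/

noncomputable section

namespace HardyDirichlet

section LeastSquares

open scoped RealInnerProductSpace

variable {ι E : Type*} [NormedAddCommGroup E] [InnerProductSpace ℝ E]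

/-- The weighted frame operator `∑_{j ∈ s} l_j ⟪v_j, ·⟫ v_j` of a finite family of vectors; the
normal equations of the least-squares problem `⟪v_j, x⟫ = A_j` with weights `l_j` are
`frameOperator v l univ x = ∑ l_j A_j v_j`. -/
def frameOperator (v : ι → E) (l : ι → ℝ) (s : Finset ι) : E →ₗ[ℝ] E :=
  ∑ j ∈ s, l j • (innerₛₗ ℝ (v j)).smulRight (v j)

/-- The weighted residual `∑ l_j (⟪v_j, x⟫ - A_j)²` of the equations `⟪v_j, x⟫ = A_j`. -/
def misfit [Fintype ι] (v : ι → E) (l A : ι → ℝ) (x : E) : ℝ :=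
  ∑ j, l j * (⟪v j, x⟫ - A j) ^ 2

lemma frameOperator_apply (v : ι → E) (l : ι → ℝ) (s : Finset ι) (x : E) :
    frameOperator v l s x = ∑ j ∈ s, (l j * ⟪v j, x⟫) • v j := by
  simp [frameOperator, LinearMap.sum_apply, smul_smul]

lemma frameOperator_insert [DecidableEq ι] (v : ι → E) (l : ι → ℝ) {s : Finset ι} {n : ι}
    (hn : n ∉ s) (x : E) :
    frameOperator v l (insert n s) x = (l n * ⟪v n, x⟫) • v n + frameOperator v l s x := by
  simp only [frameOperator_apply, Finset.sum_insert hn]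

lemma inner_frameOperator (v : ι → E) (l : ι → ℝ) (s : Finset ι) (x y : E) :
    ⟪frameOperator v l s x, y⟫ = ∑ j ∈ s, l j * ⟪v j, x⟫ * ⟪v j, y⟫ := by
  simp only [frameOperator_apply, sum_inner, real_inner_smul_left]

lemma inner_frameOperator_self_nonneg (v : ι → E) {l : ι → ℝ} (hl : ∀ j, 0 ≤ l j) (s : Finset ι)
    (x : E) : 0 ≤ ⟪frameOperator v l s x, x⟫ := by
  rw [inner_frameOperator]
  exact Finset.sum_nonneg fun j _ => by
    rw [mul_assoc]
    exact mul_nonneg (hl j) (mul_self_nonneg _)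

/-- The Sherman–Morrison formula: adding one vector to the family changes the solution of
`(lam + S) u = w` by a multiple of the solution of `(lam + S) x = v_n`. -/
lemma smul_add_frameOperator_insert [DecidableEq ι] {v : ι → E} {l : ι → ℝ}
    (hl : ∀ j, 0 ≤ l j) {lam : ℝ} (hlam : 0 ≤ lam) {s : Finset ι} {n : ι} (hn : n ∉ s) {u x w : E}
    (hu : lam • u + frameOperator v l s u = w) (hx : lam • x + frameOperator v l s x = v n) :
    let u' := u - (l n * ⟪v n, u⟫ / (l n * ⟪v n, x⟫ + 1)) • x
    lam • u' + frameOperator v l (insert n s) u' = w := by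
  intro u'
  have hvx : 0 ≤ ⟪v n, x⟫ := by
    rw [← hx, inner_add_left, real_inner_smul_left]
    exact add_nonneg (mul_nonneg hlam real_inner_self_nonneg)
      (inner_frameOperator_self_nonneg v hl s x)
  have hden : l n * ⟪v n, x⟫ + 1 ≠ 0 := by have := mul_nonneg (hl n) hvx; positivity
  set c := l n * ⟪v n, u⟫ / (l n * ⟪v n, x⟫ + 1) with hc
  have hcoef : l n * ⟪v n, u'⟫ = c := by
    rw [inner_sub_right, real_inner_smul_right, hc]
    field_simp
    ring
  calc lam • u' + frameOperator v l (insert n s) u'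
      = c • v n + ((lam • u + frameOperator v l s u) - c • (lam • x + frameOperator v l s x)) := by
        rw [frameOperator_insert v l hn, hcoef, map_sub, map_smul]
        module
    _ = w := by rw [hu, hx]; abel

lemma frameOperator_mem_span (v : ι → E) (l : ι → ℝ) (s : Finset ι) (x : E) :
    frameOperator v l s x ∈ Submodule.span ℝ (Set.range v) := by
  rw [frameOperator_apply]
  exact Submodule.sum_mem _ fun j _ =>
    Submodule.smul_mem _ _ (Submodule.subset_span (Set.mem_range_self j))

lemma inner_eq_zero_of_mem_span {v : ι → E} {x u : E} (hx : ∀ j, ⟪v j, x⟫ = 0)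
    (hu : u ∈ Submodule.span ℝ (Set.range v)) : ⟪u, x⟫ = 0 := by
  have hortho : Submodule.span ℝ (Set.range v) ⟂ Submodule.span ℝ {x} := by
    rw [Submodule.isOrtho_span]
    rintro _ ⟨j, rfl⟩ _ rfl
    exact hx j
  exact hortho.inner_eq hu (Submodule.mem_span_singleton_self x)

variable [Fintype ι] {v : ι → E} {l A : ι → ℝ}

lemma misfit_nonneg (hl : ∀ j, 0 ≤ l j) (x : E) : 0 ≤ misfit v l A x :=
  Finset.sum_nonneg fun j _ => mul_nonneg (hl j) (sq_nonneg _)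

lemma misfit_eq_zero_iff (hl : ∀ j, 0 < l j) {x : E} :
    misfit v l A x = 0 ↔ ∀ j, ⟪v j, x⟫ = A j := by
  rw [misfit, Finset.sum_eq_zero_iff_of_nonneg fun j _ => mul_nonneg (hl j).le (sq_nonneg _)]
  simp [(hl _).ne', sub_eq_zero]

/-- Completing the square around a solution of the regularized normal equation. -/
lemma regularized_misfit_eq_add {lam : ℝ} {u : E}
    (hu : lam • u + frameOperator v l Finset.univ u = ∑ j, (l j * A j) • v j) (x : E) :
    lam * ‖x‖ ^ 2 + misfit v l A x = lam * ‖u‖ ^ 2 + misfit v l A u +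
      (lam * ‖x - u‖ ^ 2 + ∑ j, l j * ⟪v j, x - u⟫ ^ 2) := by
  have hcross : lam * ⟪u, x - u⟫ + ∑ j, l j * (⟪v j, u⟫ - A j) * ⟪v j, x - u⟫ = 0 := by
    have h := congrArg (fun e => ⟪e, x - u⟫) hu
    simp only [inner_add_left, real_inner_smul_left, inner_frameOperator, sum_inner] at h
    simp only [mul_sub, sub_mul, Finset.sum_sub_distrib]
    linarith
  have hnorm : ‖x‖ ^ 2 = ‖u‖ ^ 2 + 2 * ⟪u, x - u⟫ + ‖x - u‖ ^ 2 := by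
    rw [← norm_add_sq_real, add_sub_cancel]
  have hmisfit : misfit v l A x = misfit v l A u +
      2 * ∑ j, l j * (⟪v j, u⟫ - A j) * ⟪v j, x - u⟫ + ∑ j, l j * ⟪v j, x - u⟫ ^ 2 := by
    simp only [misfit, Finset.mul_sum, ← Finset.sum_add_distrib]
    refine Finset.sum_congr rfl fun j _ => ?_
    rw [show ⟪v j, x⟫ = ⟪v j, u⟫ + ⟪v j, x - u⟫ by rw [← inner_add_right, add_sub_cancel]]
    ring
  rw [hnorm, hmisfit]
  linarith

lemma regularized_minimizer_iff (hl : ∀ j, 0 ≤ l j) {lam : ℝ} (hlam : 0 < lam) {u : E}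
    (hu : lam • u + frameOperator v l Finset.univ u = ∑ j, (l j * A j) • v j) {x : E} :
    (∀ y, lam * ‖x‖ ^ 2 + misfit v l A x ≤ lam * ‖y‖ ^ 2 + misfit v l A y) ↔ x = u := by
  have hexcess (y : E) : 0 ≤ ∑ j, l j * ⟪v j, y - u⟫ ^ 2 :=
    Finset.sum_nonneg fun j _ => mul_nonneg (hl j) (sq_nonneg _)
  constructor
  · intro hmin
    have h0 : lam * ‖x - u‖ ^ 2 ≤ 0 := by
      linarith [hmin u, regularized_misfit_eq_add hu x, hexcess x]
    have hnorm : ‖x - u‖ ^ 2 = 0 := le_antisymm (by nlinarith) (sq_nonneg _)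
    rwa [sq_eq_zero_iff, norm_eq_zero, sub_eq_zero] at hnorm
  · rintro rfl y
    rw [regularized_misfit_eq_add hu y]
    have := mul_nonneg hlam.le (sq_nonneg ‖y - x‖)
    linarith [hexcess y]

lemma misfit_minimizer_iff (hl : ∀ j, 0 < l j) {u : E}
    (hu : frameOperator v l Finset.univ u = ∑ j, (l j * A j) • v j) {x : E} :
    (∀ y, misfit v l A x ≤ misfit v l A y) ↔ ∀ j, ⟪v j, x - u⟫ = 0 := by
  have hu0 : (0 : ℝ) • u + frameOperator v l Finset.univ u = ∑ j, (l j * A j) • v j := by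
    rwa [zero_smul, zero_add]
  have hexpand (y : E) :
      misfit v l A y = misfit v l A u + misfit v l 0 (y - u) := by
    simpa [misfit] using regularized_misfit_eq_add hu0 y
  have hzero : misfit v l 0 (x - u) = 0 ↔ ∀ j, ⟪v j, x - u⟫ = 0 := misfit_eq_zero_iff hl
  have hnonneg (y : E) : 0 ≤ misfit v l 0 (y - u) := misfit_nonneg (fun j => (hl j).le) _
  rw [← hzero]
  constructor
  · intro hmin
    linarith [hmin u, hexpand x, hnonneg x]
  · intro h y
    linarith [hexpand x, hexpand y, hnonneg y]

/-- The solution of the normal equations in the span of the `v_j` is orthogonal to all the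
differences with other least-squares solutions, so Pythagoras' theorem applies. -/
lemma minimalNorm_minimizer_iff (hl : ∀ j, 0 < l j) {u : E}
    (hu : frameOperator v l Finset.univ u = ∑ j, (l j * A j) • v j)
    (hspan : u ∈ Submodule.span ℝ (Set.range v)) {x : E} :
    ((∀ y, misfit v l A x ≤ misfit v l A y) ∧
      ∀ y, (∀ y', misfit v l A y ≤ misfit v l A y') → ‖x‖ ≤ ‖y‖) ↔ x = u := by
  have hpyth {y : E} (hy : ∀ y', misfit v l A y ≤ misfit v l A y') :
      ‖y‖ ^ 2 = ‖u‖ ^ 2 + ‖y - u‖ ^ 2 := by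
    rw [misfit_minimizer_iff hl hu] at hy
    have horth := inner_eq_zero_of_mem_span hy hspan
    have := norm_add_sq_real u (y - u)
    rwa [add_sub_cancel, horth, mul_zero, add_zero] at this
  have hmin : ∀ y, misfit v l A u ≤ misfit v l A y :=
    (misfit_minimizer_iff hl hu).2 fun j => by rw [sub_self, inner_zero_right]
  constructor
  · rintro ⟨hx, hle⟩
    have hsq := pow_le_pow_left₀ (norm_nonneg x) (hle u hmin) 2
    have h0 : ‖x - u‖ ^ 2 = 0 := le_antisymm (by linarith [hpyth hx]) (sq_nonneg _)
    rwa [sq_eq_zero_iff, norm_eq_zero, sub_eq_zero] at h0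
  · rintro rfl
    refine ⟨hmin, fun y hy => le_of_sq_le_sq ?_ (norm_nonneg y)⟩
    linarith [hpyth hy, sq_nonneg ‖y - x‖]

lemma exists_frameOperator_eq (hl : ∀ j, 0 < l j) {w : E}
    (hw : w ∈ Submodule.span ℝ (Set.range v)) :
    ∃ u ∈ Submodule.span ℝ (Set.range v), frameOperator v l Finset.univ u = w := by
  set V := Submodule.span ℝ (Set.range v)
  have : FiniteDimensional ℝ V := FiniteDimensional.span_of_finite ℝ (Set.finite_range v)
  let S : V →ₗ[ℝ] V := (frameOperator v l Finset.univ).restrict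
    fun x _ => frameOperator_mem_span v l Finset.univ x
  have hinj : Function.Injective S := by
    rw [← LinearMap.ker_eq_bot, LinearMap.ker_eq_bot']
    rintro ⟨x, hx⟩ hSx
    have hSx' : frameOperator v l Finset.univ x = 0 := congrArg Subtype.val hSx
    have hmis : misfit v l 0 x = 0 := by
      calc misfit v l 0 x = ⟪frameOperator v l Finset.univ x, x⟫ := by
            simp [misfit, inner_frameOperator, sq, mul_assoc]
        _ = 0 := by rw [hSx', inner_zero_left]
    have hxx := inner_eq_zero_of_mem_span ((misfit_eq_zero_iff hl).1 hmis) hx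
    exact Subtype.ext (inner_self_eq_zero.1 hxx)
  obtain ⟨u, hu⟩ := LinearMap.surjective_of_injective hinj ⟨w, hw⟩
  exact ⟨u, u.2, congrArg Subtype.val hu⟩

lemma norm_sub_sq_le_of_regularized (hl : ∀ j, 0 ≤ l j) {lam : ℝ} (hlam : 0 < lam) {u w : E}
    (a : ι → ℝ) (hu : u = ∑ j, (l j * a j) • v j)
    (hw : lam • w + frameOperator v l Finset.univ w = frameOperator v l Finset.univ u) :
    ‖w - u‖ ^ 2 ≤ lam / 4 * ∑ j, l j * a j ^ 2 := by
  have herror : lam • (w - u) + frameOperator v l Finset.univ (w - u) = -(lam • u) := by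
    rw [map_sub, ← hw]
    module
  have henergy : lam * ‖w - u‖ ^ 2 + ∑ j, l j * ⟪v j, w - u⟫ ^ 2 =
      -(lam * ∑ j, l j * a j * ⟪v j, w - u⟫) := by
    have h := congrArg (fun e => ⟪e, w - u⟫) herror
    simp only [inner_add_left, real_inner_smul_left, inner_frameOperator, inner_neg_left,
      real_inner_self_eq_norm_sq, mul_assoc, ← sq] at h
    have hpair := congrArg (fun e => ⟪e, w - u⟫) hu
    simp only [sum_inner, real_inner_smul_left] at hpair
    rw [h, hpair]
  have hsquare : 0 ≤ ∑ j, l j * (⟪v j, w - u⟫ + lam / 2 * a j) ^ 2 :=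
    Finset.sum_nonneg fun j _ => mul_nonneg (hl j) (sq_nonneg _)
  have hexpand : ∑ j, l j * (⟪v j, w - u⟫ + lam / 2 * a j) ^ 2 =
      ∑ j, l j * ⟪v j, w - u⟫ ^ 2 + lam * ∑ j, l j * a j * ⟪v j, w - u⟫ +
        lam ^ 2 / 4 * ∑ j, l j * a j ^ 2 := by
    simp only [Finset.mul_sum, ← Finset.sum_add_distrib]
    exact Finset.sum_congr rfl fun j _ => by ring
  refine le_of_mul_le_mul_left ?_ hlam
  linarith

lemma tendsto_of_regularized (hl : ∀ j, 0 < l j) {u : E}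
    (hspan : u ∈ Submodule.span ℝ (Set.range v)) {w : ℝ → E}
    (hw : ∀ lam, 0 < lam → lam • w lam + frameOperator v l Finset.univ (w lam) =
      frameOperator v l Finset.univ u) :
    Tendsto w (𝓝[>] 0) (𝓝 u) := by
  obtain ⟨c, hc⟩ := (Submodule.mem_span_range_iff_exists_fun ℝ).1 hspan
  have hu : u = ∑ j, (l j * (c j / l j)) • v j := by
    simp only [mul_div_cancel₀ _ (hl _).ne', hc]
  have hbound : Tendsto (fun lam : ℝ => lam / 4 * ∑ j, l j * (c j / l j) ^ 2) (𝓝[>] 0) (𝓝 0) := by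
    refine tendsto_nhdsWithin_of_tendsto_nhds (Continuous.tendsto' (by fun_prop) _ _ ?_)
    rw [zero_div, zero_mul]
  have hsq : Tendsto (fun lam => ‖w lam - u‖ ^ 2) (𝓝[>] 0) (𝓝 0) := by
    refine squeeze_zero' (Eventually.of_forall fun _ => sq_nonneg _) ?_ hbound
    filter_upwards [self_mem_nhdsWithin] with lam hlam
    exact norm_sub_sq_le_of_regularized (fun j => (hl j).le) hlam _ hu (hw lam hlam)
  rw [tendsto_iff_norm_sub_tendsto_zero]
  simpa using hsq.sqrt

end LeastSquares

section ContourShift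

variable {E : Type*} [NormedAddCommGroup E]

/-- The restriction `x ↦ f (x + iy)` of a function to the horizontal line `Im = y`, on which
norms and integrals are taken. -/
def line (f : ℂ → E) (y x : ℝ) : E :=
  f (x + y * Complex.I)

lemma continuous_line_of_continuousOn {f : ℂ → E} {s : Set ℝ} (hf : ContinuousOn f {w | w.im ∈ s})
    {y : ℝ} (hy : y ∈ s) : Continuous (line f y) :=
  hf.comp_continuous (by fun_prop) fun x => by simpa using hy

lemma integrable_strip {f : ℂ → E} {a b M : ℝ} (hf : ContinuousOn f {w | w.im ∈ Set.Icc a b})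
    (hint : ∀ t ∈ Set.Icc a b, Integrable (line f t))
    (hM : ∀ t ∈ Set.Icc a b, ∫ x, ‖line f t x‖ ≤ M) :
    Integrable (fun p : ℝ × ℝ => line f p.2 p.1)
      (volume.prod (volume.restrict (Set.Ioc a b))) := by
  have hmeas : AEStronglyMeasurable (fun p : ℝ × ℝ => line f p.2 p.1)
      (volume.prod (volume.restrict (Set.Ioc a b))) := by
    rw [show (volume : Measure ℝ).prod (volume.restrict (Set.Ioc a b)) =
      (volume.prod volume).restrict (Set.univ ×ˢ Set.Ioc a b) by
        rw [← Measure.prod_restrict, Measure.restrict_univ]]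
    refine ContinuousOn.aestronglyMeasurable ?_ (MeasurableSet.univ.prod measurableSet_Ioc)
    refine hf.comp (by fun_prop) fun p hp => ?_
    simpa using Set.Ioc_subset_Icc_self hp.2
  rw [integrable_prod_iff' hmeas]
  constructor
  · filter_upwards [ae_restrict_mem measurableSet_Ioc] with t ht
    exact hint t (Set.Ioc_subset_Icc_self ht)
  · refine Integrable.mono' (integrable_const M) hmeas.norm.prod_swap.integral_prod_right' ?_
    filter_upwards [ae_restrict_mem measurableSet_Ioc] with t ht
    rw [Real.norm_of_nonneg (integral_nonneg fun _ => norm_nonneg _)]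
    exact hM t (Set.Ioc_subset_Icc_self ht)

variable [NormedSpace ℂ E] {f : ℂ → E} {a b M : ℝ}

lemma integral_line_sub_integral_line (hab : a ≤ b)
    (hf : DifferentiableOn ℂ f {w | w.im ∈ Set.Icc a b}) (R : ℝ) :
    (∫ x in (-R)..R, line f a x) - ∫ x in (-R)..R, line f b x =
      Complex.I • ((∫ t in a..b, line f t (-R)) - ∫ t in a..b, line f t R) := by
  have hrect : (∫ x in (-R)..R, line f a x) - (∫ x in (-R)..R, line f b x) +
      Complex.I • (∫ t in a..b, line f t R) - Complex.I • ∫ t in a..b, line f t (-R) = 0 :=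
    Complex.integral_boundary_rect_eq_zero_of_differentiableOn f ⟨-R, a⟩ ⟨R, b⟩ <|
      hf.mono fun w hw => by simpa [Set.uIcc_of_le hab] using hw.2
  rw [smul_sub, ← sub_eq_zero, ← hrect]
  abel

/-- Cauchy's theorem on the rectangles `[-R, R] × [a, b]`: the contribution of the vertical sides
is an integrable function of `R` which has a limit as `R → ∞`, so that this limit is zero. -/
lemma integral_line_eq (hab : a ≤ b) (hf : DifferentiableOn ℂ f {w | w.im ∈ Set.Icc a b})
    (hint : ∀ t ∈ Set.Icc a b, Integrable (line f t))
    (hM : ∀ t ∈ Set.Icc a b, ∫ x, ‖line f t x‖ ≤ M) :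
    ∫ x, line f a x = ∫ x, line f b x := by
  set V : ℝ → E := fun x => ∫ t in a..b, line f t x with hV
  have hVint : Integrable V := by
    simpa only [hV, intervalIntegral.integral_of_le hab] using
      (integrable_strip hf.continuousOn hint hM).integral_prod_left
  have hlim : Tendsto (fun R : ℝ => Complex.I • (V (-R) - V R)) atTop
      (𝓝 ((∫ x, line f a x) - ∫ x, line f b x)) := by
    simp only [hV, ← integral_line_sub_integral_line hab hf]
    have htendsto {t : ℝ} (ht : t ∈ Set.Icc a b) :=
      intervalIntegral_tendsto_integral (hint t ht) tendsto_neg_atTop_atBot tendsto_id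
    exact (htendsto (Set.left_mem_Icc.2 hab)).sub (htendsto (Set.right_mem_Icc.2 hab))
  have hzero := IntegrableAtFilter.eq_zero_of_tendsto
    (((hVint.comp_neg.sub hVint).smul Complex.I).integrableAtFilter atTop) ?_ hlim
  · exact sub_eq_zero.1 hzero
  · intro s hs
    obtain ⟨R, hR⟩ := mem_atTop_sets.1 hs
    exact measure_mono_top (fun x hx => hR x hx) Real.volume_Ici

end ContourShift

section SquareIntegrable

variable {α E : Type*} [MeasurableSpace α] {μ : Measure α} [NormedAddCommGroup E]

lemma lpNorm_two_sq {f : α → E} (hf : AEStronglyMeasurable f μ) :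
    lpNorm f 2 μ ^ 2 = ∫ x, ‖f x‖ ^ 2 ∂μ := by
  rw [lpNorm_eq_integral_norm_rpow_toReal two_ne_zero ENNReal.ofNat_ne_top hf]
  simp only [ENNReal.toReal_ofNat, Real.rpow_two, ← Real.sqrt_eq_rpow, ← one_div]
  exact Real.sq_sqrt (integral_nonneg fun x => sq_nonneg _)

lemma integral_norm_mul_le {f g : α → ℂ} (hf : MemLp f 2 μ) (hg : MemLp g 2 μ) :
    ∫ x, ‖f x * g x‖ ∂μ ≤ lpNorm f 2 μ * lpNorm g 2 μ := by
  have hholder : eLpNorm (f * g) 1 μ ≤ eLpNorm f 2 μ * eLpNorm g 2 μ := by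
    rw [← smul_eq_mul f g]
    exact eLpNorm_smul_le_mul_eLpNorm hg.1 hf.1
  calc ∫ x, ‖(f * g) x‖ ∂μ = (eLpNorm (f * g) 1 μ).toReal := by
        rw [toReal_eLpNorm (hf.1.mul hg.1), lpNorm_one_eq_integral_norm (hf.1.mul hg.1)]
    _ ≤ (eLpNorm f 2 μ * eLpNorm g 2 μ).toReal :=
        ENNReal.toReal_mono (ENNReal.mul_ne_top hf.2.ne hg.2.ne) hholder
    _ = lpNorm f 2 μ * lpNorm g 2 μ := by
        rw [ENNReal.toReal_mul, toReal_eLpNorm hf.1, toReal_eLpNorm hg.1]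

end SquareIntegrable

section HardyLines

/-- The extension of a function on the upper half-plane to `ℂ` along which `MemHardy` expresses
holomorphy; its values outside the half-plane are never used. -/
def extend (F : ℍ → ℂ) (w : ℂ) : ℂ :=
  F (UpperHalfPlane.ofComplex w)

variable {F : ℍ → ℂ} {y : ℝ}

lemma extend_coe (F : ℍ → ℂ) (w : ℍ) : extend F w = F w := by
  rw [extend, UpperHalfPlane.ofComplex_apply]

lemma line_extend (F : ℍ → ℂ) (hy : 0 < y) (x : ℝ) : line (extend F) y x = F ⟨⟨x, y⟩, hy⟩ := by
  rw [line, ← Complex.mk_eq_add_mul_I]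
  exact extend_coe F ⟨⟨x, y⟩, hy⟩

lemma hardyENorm_eq (F : ℍ → ℂ) :
    hardyENorm F = ⨆ y : {y : ℝ // 0 < y}, eLpNorm (line (extend F) y) 2 volume := by
  refine iSup_congr fun y => ?_
  rw [funext (line_extend F y.2)]

lemma eLpNorm_line_le (F : ℍ → ℂ) (hy : 0 < y) :
    eLpNorm (line (extend F) y) 2 volume ≤ hardyENorm F := by
  rw [hardyENorm_eq]
  exact le_iSup (fun y : {y : ℝ // 0 < y} => eLpNorm (line (extend F) y) 2 volume) ⟨y, hy⟩

namespace MemHardy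

lemma differentiableAt (hF : MemHardy F) {w : ℂ} (hw : 0 < w.im) :
    DifferentiableAt ℂ (extend F) w :=
  hF.1.differentiableAt (UpperHalfPlane.isOpen_upperHalfPlaneSet.mem_nhds hw)

lemma continuous_line (hF : MemHardy F) (hy : 0 < y) : Continuous (line (extend F) y) :=
  continuous_line_of_continuousOn (s := Set.Ioi 0) hF.1.continuousOn hy

lemma memLp_line (hF : MemHardy F) (hy : 0 < y) : MemLp (line (extend F) y) 2 volume :=
  ⟨(hF.continuous_line hy).aestronglyMeasurable, (eLpNorm_line_le F hy).trans_lt hF.2⟩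

lemma lpNorm_line_le (hF : MemHardy F) (hy : 0 < y) :
    lpNorm (line (extend F) y) 2 volume ≤ hardyNorm F := by
  rw [← toReal_eLpNorm (hF.memLp_line hy).1]
  exact ENNReal.toReal_mono hF.2.ne (eLpNorm_line_le F hy)

end MemHardy

lemma apply_one_le_of_midpoint_convex {s : ℕ → ℝ} {M : ℝ} (hM : ∀ k, s k ≤ M)
    (hs : ∀ k, 2 * s (k + 1) ≤ s k + s (k + 2)) : s 1 ≤ s 0 := by
  by_contra! hlt
  have hstep (k : ℕ) : s 1 - s 0 ≤ s (k + 1) - s k := by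
    induction k with
    | zero => rfl
    | succ k ih => linarith [hs k]
  have hgrow (k : ℕ) : k * (s 1 - s 0) ≤ s k - s 0 := by
    induction k with
    | zero => simp
    | succ k ih => push_cast; linarith [hstep k]
  obtain ⟨k, hk⟩ := exists_lt_nsmul (sub_pos.2 hlt) (M - s 0)
  rw [nsmul_eq_mul] at hk
  linarith [hgrow k, hM k]

/-- The function `w ↦ F(w) · conj F(conj w + 2ib)`: it is holomorphic on the strip
`0 < Im w < 2b` and equals `|F|²` on the line `Im w = b`. -/
def reflectedProduct (F : ℍ → ℂ) (b : ℝ) (w : ℂ) : ℂ :=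
  extend F w * (starRingEnd ℂ) (extend F ((starRingEnd ℂ) w + 2 * b * Complex.I))

lemma line_reflectedProduct (F : ℍ → ℂ) (b t : ℝ) : line (reflectedProduct F b) t =
    line (extend F) t * (starRingEnd (ℝ → ℂ)) (line (extend F) (2 * b - t)) := by
  ext x
  simp only [reflectedProduct, line, Pi.mul_apply, Pi.conj_apply, map_add, map_mul,
    Complex.conj_ofReal, Complex.conj_I]
  push_cast
  ring_nf

namespace MemHardy

lemma differentiableOn_reflectedProduct (hF : MemHardy F) (b : ℝ) :
    DifferentiableOn ℂ (reflectedProduct F b) {w | w.im ∈ Set.Ioo 0 (2 * b)} := by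
  intro w hw
  have hreflected : 0 < ((starRingEnd ℂ) w + 2 * b * Complex.I).im := by
    simpa using hw.2
  have hg : DifferentiableAt ℂ (fun v => extend F (v + 2 * b * Complex.I)) ((starRingEnd ℂ) w) := by
    rw [differentiableAt_comp_add_const]
    exact hF.differentiableAt hreflected
  exact ((hF.differentiableAt hw.1).mul
    (differentiableAt_conj_conj_iff.2 hg)).differentiableWithinAt

variable {b t : ℝ}

lemma integrable_line_reflectedProduct (hF : MemHardy F) (ht : t ∈ Set.Ioo 0 (2 * b)) :
    Integrable (line (reflectedProduct F b) t) := by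
  rw [line_reflectedProduct]
  exact (hF.memLp_line ht.1).integrable_mul (hF.memLp_line (sub_pos.2 ht.2)).star

lemma integral_norm_line_reflectedProduct_le (hF : MemHardy F) (ht : t ∈ Set.Ioo 0 (2 * b)) :
    ∫ x, ‖line (reflectedProduct F b) t x‖ ≤
      lpNorm (line (extend F) t) 2 volume * lpNorm (line (extend F) (2 * b - t)) 2 volume := by
  rw [line_reflectedProduct, ← lpNorm_conj (line (extend F) (2 * b - t))]
  exact integral_norm_mul_le (hF.memLp_line ht.1) (hF.memLp_line (sub_pos.2 ht.2)).star

lemma integral_line_reflectedProduct_self (hF : MemHardy F) (hb : 0 < b) :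
    ∫ x, line (reflectedProduct F b) b x = (lpNorm (line (extend F) b) 2 volume ^ 2 : ℝ) := by
  rw [lpNorm_two_sq (hF.memLp_line hb).1, ← integral_complex_ofReal, line_reflectedProduct,
    two_mul, add_sub_cancel_right]
  simp only [Pi.mul_apply, Pi.conj_apply, Complex.mul_conj, Complex.normSq_eq_norm_sq]

lemma sq_lpNorm_line_le (hF : MemHardy F) {a : ℝ} (ha : 0 < a) (hab : a ≤ b) :
    lpNorm (line (extend F) b) 2 volume ^ 2 ≤
      lpNorm (line (extend F) a) 2 volume * lpNorm (line (extend F) (2 * b - a)) 2 volume := by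
  have hmem {t : ℝ} (ht : t ∈ Set.Icc a b) : t ∈ Set.Ioo 0 (2 * b) :=
    ⟨ha.trans_le ht.1, by linarith [ht.2]⟩
  have hshift : ∫ x, line (reflectedProduct F b) a x = ∫ x, line (reflectedProduct F b) b x := by
    refine integral_line_eq (M := hardyNorm F * hardyNorm F) hab
      ((hF.differentiableOn_reflectedProduct b).mono fun w hw => hmem hw)
      (fun t ht => hF.integrable_line_reflectedProduct (hmem ht)) fun t ht =>
      (hF.integral_norm_line_reflectedProduct_le (hmem ht)).trans ?_
    exact mul_le_mul (hF.lpNorm_line_le (hmem ht).1) (hF.lpNorm_line_le (sub_pos.2 (hmem ht).2))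
      lpNorm_nonneg ENNReal.toReal_nonneg
  calc lpNorm (line (extend F) b) 2 volume ^ 2
      = ‖∫ x, line (reflectedProduct F b) a x‖ := by
        rw [hshift, hF.integral_line_reflectedProduct_self (ha.trans_le hab), Complex.norm_real,
          Real.norm_of_nonneg (sq_nonneg _)]
    _ ≤ _ := (norm_integral_le_integral_norm _).trans
        (hF.integral_norm_line_reflectedProduct_le (hmem (Set.left_mem_Icc.2 hab)))

lemma lpNorm_line_antitoneOn (hF : MemHardy F) :
    AntitoneOn (fun y => lpNorm (line (extend F) y) 2 volume) (Set.Ioi 0) := by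
  intro a ha b _ hab
  have ha : 0 < a := ha
  have hpos (k : ℕ) : 0 < a + k * (b - a) := by
    have := mul_nonneg k.cast_nonneg (sub_nonneg.2 hab)
    positivity
  have hle := apply_one_le_of_midpoint_convex (M := hardyNorm F)
    (s := fun k : ℕ => lpNorm (line (extend F) (a + k * (b - a))) 2 volume)
    (fun k => hF.lpNorm_line_le (hpos k)) fun k => by
      have hconvex := hF.sq_lpNorm_line_le (hpos k)
        (b := a + (k + 1 : ℕ) * (b - a)) (by push_cast; linarith)
      rw [show 2 * (a + (k + 1 : ℕ) * (b - a)) - (a + k * (b - a)) = a + (k + 2 : ℕ) * (b - a) by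
        push_cast; ring] at hconvex
      refine abs_le_of_sq_le_sq' ?_ (add_nonneg lpNorm_nonneg lpNorm_nonneg) |>.2
      linarith [sq_nonneg (lpNorm (line (extend F) (a + k * (b - a))) 2 volume -
        lpNorm (line (extend F) (a + (k + 2 : ℕ) * (b - a))) 2 volume)]
  simpa using hle

end MemHardy

end HardyLines

section CauchyKernel

variable {c : ℂ} {y : ℝ}

lemma integral_inv_sub_sq_add_sq (a : ℝ) {b : ℝ} (hb : 0 < b) :
    ∫ x : ℝ, ((x - a) ^ 2 + b ^ 2)⁻¹ = Real.pi / b := by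
  have hcauchy := ProbabilityTheory.integral_cauchyPDFReal_eq_one a (γ := ⟨b, hb.le⟩)
    fun h => hb.ne' (congrArg NNReal.toReal h)
  have hpdf : Real.pi⁻¹ * b * ∫ x : ℝ, ((x - a) ^ 2 + b ^ 2)⁻¹ = 1 := by
    rw [← integral_const_mul]
    exact hcauchy
  field_simp at hpdf ⊢
  linarith

lemma integrable_inv_sub_sq_add_sq (a : ℝ) {b : ℝ} (hb : 0 < b) :
    Integrable fun x : ℝ => ((x - a) ^ 2 + b ^ 2)⁻¹ := by
  apply Integrable.of_integral_ne_zero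
  rw [integral_inv_sub_sq_add_sq a hb]
  positivity

lemma sq_norm_line_inv_sub (c : ℂ) (y x : ℝ) :
    ‖line (fun v => (v - c)⁻¹) y x‖ ^ 2 = ((x - c.re) ^ 2 + (y - c.im) ^ 2)⁻¹ := by
  rw [line, norm_inv, inv_pow, ← Complex.normSq_eq_norm_sq, Complex.normSq_apply]
  simp [sq]

lemma memLp_line_inv_sub (hy : c.im < y) :
    MemLp (line (fun v => (v - c)⁻¹) y) 2 volume := by
  have hmeas : AEStronglyMeasurable (line (fun v => (v - c)⁻¹) y) volume := by
    unfold line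
    fun_prop
  rw [memLp_two_iff_integrable_sq_norm hmeas]
  simpa only [sq_norm_line_inv_sub] using integrable_inv_sub_sq_add_sq c.re (sub_pos.2 hy)

lemma sq_lpNorm_line_inv_sub (hy : c.im < y) :
    lpNorm (line (fun v => (v - c)⁻¹) y) 2 volume ^ 2 = Real.pi / (y - c.im) := by
  rw [lpNorm_two_sq (memLp_line_inv_sub hy).1]
  simp only [sq_norm_line_inv_sub, integral_inv_sub_sq_add_sq c.re (sub_pos.2 hy)]

end CauchyKernel

section DividedDifference

variable {F : ℍ → ℂ} {c : ℂ}

lemma line_dslope_of_ne (hzero : extend F c = 0) {t x : ℝ} (hne : (x + t * Complex.I : ℂ) ≠ c) :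
    line (dslope (extend F) c) t x = line (fun v => (v - c)⁻¹) t x * line (extend F) t x := by
  simp only [line, dslope_of_ne _ hne, slope_def_module, hzero, sub_zero, smul_eq_mul]

lemma norm_line_dslope_le_of_one_lt (hzero : extend F c = 0) {t x : ℝ} (hx : 1 < |x - c.re|) :
    ‖line (dslope (extend F) c) t x‖ ≤
      ‖line (extend F) t x‖ ^ 2 + 2 * ((x - c.re) ^ 2 + 1 ^ 2)⁻¹ := by
  have hne : (x + t * Complex.I : ℂ) ≠ c := by
    rintro rfl
    norm_num at hx
  have hsq : 1 < (x - c.re) ^ 2 := (one_lt_sq_iff_one_lt_abs _).2 hx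
  have hinv : ‖line (fun v => (v - c)⁻¹) t x‖ ^ 2 ≤ 2 * ((x - c.re) ^ 2 + 1 ^ 2)⁻¹ := by
    rw [sq_norm_line_inv_sub, ← div_eq_mul_inv, inv_le_comm₀ (by positivity) (by positivity),
      inv_div, div_le_iff₀ two_pos]
    nlinarith [sq_nonneg (t - c.im)]
  rw [line_dslope_of_ne hzero hne, norm_mul]
  nlinarith [sq_nonneg (‖line (fun v => (v - c)⁻¹) t x‖ - ‖line (extend F) t x‖),
    sq_nonneg ‖line (fun v => (v - c)⁻¹) t x‖, sq_nonneg ‖line (extend F) t x‖]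

namespace MemHardy

lemma differentiableOn_dslope (hF : MemHardy F) (hc : 0 < c.im) :
    DifferentiableOn ℂ (dslope (extend F) c) {w | 0 < w.im} :=
  (Complex.differentiableOn_dslope (UpperHalfPlane.isOpen_upperHalfPlaneSet.mem_nhds hc)).2 hF.1

lemma exists_norm_line_dslope_le (hF : MemHardy F) (hc : 0 < c.im) (hzero : extend F c = 0)
    {a : ℝ} (ha : 0 < a) (b : ℝ) : ∃ C, ∀ t ∈ Set.Icc a b, ∀ x,
      ‖line (dslope (extend F) c) t x‖ ≤
        ‖line (extend F) t x‖ ^ 2 + C * ((x - c.re) ^ 2 + 1 ^ 2)⁻¹ := by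
  obtain ⟨B, hB⟩ := ((isCompact_Icc (a := c.re - 1) (b := c.re + 1)).reProdIm
    (isCompact_Icc (a := a) (b := b))).exists_bound_of_continuousOn
    ((hF.differentiableOn_dslope hc).continuousOn.mono fun w hw => ha.trans_le hw.2.1)
  refine ⟨2 * |B| + 2, fun t ht x => ?_⟩
  rcases le_or_gt |x - c.re| 1 with hnear | hfar
  · have hmem : (x + t * Complex.I : ℂ) ∈ Set.Icc (c.re - 1) (c.re + 1) ×ℂ Set.Icc a b := by
      rw [abs_le] at hnear
      rw [← Complex.mk_eq_add_mul_I]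
      exact ⟨⟨by linarith [hnear.1], by linarith [hnear.2]⟩, ht⟩
    have hweight : 2⁻¹ ≤ ((x - c.re) ^ 2 + 1 ^ 2)⁻¹ := by
      gcongr
      linarith [(sq_le_one_iff_abs_le_one _).2 hnear]
    calc ‖line (dslope (extend F) c) t x‖ ≤ |B| := (hB _ hmem).trans (le_abs_self B)
      _ ≤ (2 * |B| + 2) * 2⁻¹ := by linarith
      _ ≤ (2 * |B| + 2) * ((x - c.re) ^ 2 + 1 ^ 2)⁻¹ := by gcongr
      _ ≤ _ := le_add_of_nonneg_left (sq_nonneg _)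
  · refine (norm_line_dslope_le_of_one_lt hzero hfar).trans ?_
    gcongr
    linarith [abs_nonneg B]

lemma integrable_sq_norm_line (hF : MemHardy F) {y : ℝ} (hy : 0 < y) :
    Integrable fun x => ‖line (extend F) y x‖ ^ 2 :=
  (memLp_two_iff_integrable_sq_norm (hF.memLp_line hy).1).1 (hF.memLp_line hy)

lemma integrable_line_dslope (hF : MemHardy F) (hc : 0 < c.im) (hzero : extend F c = 0) {y : ℝ}
    (hy : 0 < y) : Integrable (line (dslope (extend F) c) y) := by
  obtain ⟨C, hC⟩ := hF.exists_norm_line_dslope_le hc hzero hy y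
  refine Integrable.mono' ((hF.integrable_sq_norm_line hy).add
    ((integrable_inv_sub_sq_add_sq c.re one_pos).const_mul C)) ?_
    (Eventually.of_forall (hC y ⟨le_rfl, le_rfl⟩))
  exact (continuous_line_of_continuousOn (s := Set.Ioi 0)
    (hF.differentiableOn_dslope hc).continuousOn hy).aestronglyMeasurable

lemma integral_line_dslope_eq (hF : MemHardy F) (hc : 0 < c.im) (hzero : extend F c = 0)
    {a b : ℝ} (ha : 0 < a) (hab : a ≤ b) :
    ∫ x, line (dslope (extend F) c) a x = ∫ x, line (dslope (extend F) c) b x := by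
  obtain ⟨C, hC⟩ := hF.exists_norm_line_dslope_le hc hzero ha b
  have hpos {t : ℝ} (ht : t ∈ Set.Icc a b) : 0 < t := ha.trans_le ht.1
  have hdecay := (integrable_inv_sub_sq_add_sq c.re one_pos).const_mul C
  refine integral_line_eq
    (M := hardyNorm F ^ 2 + ∫ x : ℝ, C * ((x - c.re) ^ 2 + 1 ^ 2)⁻¹) hab
    ((hF.differentiableOn_dslope hc).mono fun w hw => hpos hw)
    (fun t ht => hF.integrable_line_dslope hc hzero (hpos ht)) fun t ht => ?_
  calc ∫ x, ‖line (dslope (extend F) c) t x‖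
      ≤ ∫ x, (‖line (extend F) t x‖ ^ 2 + C * ((x - c.re) ^ 2 + 1 ^ 2)⁻¹) :=
        integral_mono (hF.integrable_line_dslope hc hzero (hpos ht)).norm
          ((hF.integrable_sq_norm_line (hpos ht)).add hdecay) (hC t ht)
    _ = lpNorm (line (extend F) t) 2 volume ^ 2 + ∫ x : ℝ, C * ((x - c.re) ^ 2 + 1 ^ 2)⁻¹ := by
        rw [integral_add (hF.integrable_sq_norm_line (hpos ht)) hdecay,
          lpNorm_two_sq (hF.memLp_line (hpos ht)).1]
    _ ≤ _ := by
        gcongr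
        exacts [lpNorm_nonneg, hF.lpNorm_line_le (hpos ht)]

lemma norm_integral_line_dslope_le (hF : MemHardy F) (hzero : extend F c = 0) {t : ℝ} (ht : 0 < t)
    (hct : c.im < t) :
    ‖∫ x, line (dslope (extend F) c) t x‖ ≤ √(Real.pi / (t - c.im)) * hardyNorm F := by
  have hne (x : ℝ) : (x + t * Complex.I : ℂ) ≠ c := by
    rintro rfl
    simp at hct
  simp only [line_dslope_of_ne hzero (hne _)]
  calc _ ≤ _ := norm_integral_le_integral_norm _
    _ ≤ _ := integral_norm_mul_le (memLp_line_inv_sub hct) (hF.memLp_line ht)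
    _ ≤ _ := by
        rw [← sq_lpNorm_line_inv_sub hct, Real.sqrt_sq lpNorm_nonneg]
        exact mul_le_mul_of_nonneg_left (hF.lpNorm_line_le ht) lpNorm_nonneg

/-- The integral does not depend on the line, and it vanishes in the limit `Im → ∞`. -/
lemma integral_line_dslope_eq_zero (hF : MemHardy F) (hc : 0 < c.im) (hzero : extend F c = 0)
    {y : ℝ} (hy : 0 < y) : ∫ x, line (dslope (extend F) c) y x = 0 := by
  have hlim : Tendsto (fun t => √(Real.pi / (t - c.im)) * hardyNorm F) atTop (𝓝 0) := by
    have hdiv : Tendsto (fun t => Real.pi / (t - c.im)) atTop (𝓝 0) :=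
      tendsto_const_nhds.div_atTop (tendsto_atTop_add_const_right _ _ tendsto_id)
    simpa using hdiv.sqrt.mul_const (hardyNorm F)
  refine norm_le_zero_iff.1 (ge_of_tendsto hlim ?_)
  filter_upwards [eventually_ge_atTop y, eventually_gt_atTop c.im] with t hyt hct
  rw [hF.integral_line_dslope_eq hc hzero hy hyt]
  exact hF.norm_integral_line_dslope_le hzero (hy.trans_le hyt) hct

end MemHardy

end DividedDifference

section HardySubmodule

variable {F G : ℍ → ℂ}

namespace MemHardy

lemma add (hF : MemHardy F) (hG : MemHardy G) : MemHardy (F + G) := by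
  refine ⟨hF.1.add hG.1, lt_of_le_of_lt ?_ (ENNReal.add_lt_top.2 ⟨hF.2, hG.2⟩)⟩
  rw [hardyENorm_eq (F + G)]
  exact iSup_le fun y => (eLpNorm_add_le (hF.memLp_line y.2).1 (hG.memLp_line y.2).1
    one_le_two).trans (add_le_add (eLpNorm_line_le F y.2) (eLpNorm_line_le G y.2))

lemma const_smul (a : ℂ) (hF : MemHardy F) : MemHardy (a • F) := by
  refine ⟨hF.1.const_smul a, lt_of_le_of_lt ?_ (ENNReal.mul_lt_top (enorm_lt_top (x := a)) hF.2)⟩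
  rw [hardyENorm_eq (a • F)]
  exact iSup_le fun y => eLpNorm_const_smul_le.trans (by gcongr; exact eLpNorm_line_le F y.2)

end MemHardy

lemma memHardy_zero : MemHardy 0 :=
  ⟨differentiableOn_const 0, by simp [hardyENorm]⟩

/-- The functions of the Hardy space `H²(ℂ⁺)`, as a subspace of all functions on the upper
half-plane. -/
def hardySubmodule : Submodule ℂ (ℍ → ℂ) where
  carrier := {F | MemHardy F}
  add_mem' := MemHardy.add
  zero_mem' := memHardy_zero
  smul_mem' a _ hF := hF.const_smul a

end HardySubmodule

section SzegoKernel

variable {F : ℍ → ℂ} {y : ℝ}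

lemma extend_szego (w : ℍ) {v : ℂ} (hv : 0 < v.im) : extend (szego · w) v =
    Complex.I / (2 * Real.pi) * (v - (starRingEnd ℂ) (w : ℂ))⁻¹ := by
  simp only [extend, szego, UpperHalfPlane.ofComplex_apply_of_im_pos hv, one_div]

lemma line_szego (w : ℍ) (hy : 0 < y) : line (extend (szego · w)) y =
    (Complex.I / (2 * Real.pi) : ℂ) • line (fun v => (v - (starRingEnd ℂ) (w : ℂ))⁻¹) y :=
  funext fun x => extend_szego w (by simpa using hy)

lemma im_conj_lt (w : ℍ) (hy : 0 < y) : ((starRingEnd ℂ) (w : ℂ)).im < y :=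
  (neg_neg_of_pos w.im_pos).trans hy

lemma sub_conj_ne_zero (q : ℍ) {v : ℂ} (hv : 0 < v.im) : v - (starRingEnd ℂ) (q : ℂ) ≠ 0 :=
  sub_ne_zero.2 fun h => (im_conj_lt q hv).ne (congrArg Complex.im h).symm

lemma memLp_line_szego (w : ℍ) (hy : 0 < y) : MemLp (line (extend (szego · w)) y) 2 volume := by
  rw [line_szego w hy]
  exact (memLp_line_inv_sub (im_conj_lt w hy)).const_smul _

lemma sq_lpNorm_line_szego (w : ℍ) (hy : 0 < y) :
    lpNorm (line (extend (szego · w)) y) 2 volume ^ 2 = (4 * Real.pi * (w.im + y))⁻¹ := by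
  have hsum : w.im + y ≠ 0 := (add_pos w.im_pos hy).ne'
  rw [line_szego w hy, lpNorm_const_smul, mul_pow, sq_lpNorm_line_inv_sub (im_conj_lt w hy)]
  simp only [coe_nnnorm, norm_div, norm_mul, Complex.norm_I, Complex.norm_ofNat, Complex.norm_real,
    Real.norm_of_nonneg Real.pi_pos.le, Complex.conj_im, sub_neg_eq_add, UpperHalfPlane.coe_im,
    add_comm y]
  field_simp [hsum]
  norm_num

lemma differentiableOn_extend_szego (w : ℍ) :
    DifferentiableOn ℂ (extend (szego · w)) {v | 0 < v.im} := by
  refine DifferentiableOn.congr (fun v hv => ?_) fun v hv => extend_szego w hv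
  have hne := sub_conj_ne_zero w hv
  fun_prop (disch := exact hne)

lemma memHardy_szego (w : ℍ) : MemHardy (szego · w) := by
  refine ⟨differentiableOn_extend_szego w, lt_of_le_of_lt ?_
    (ENNReal.ofReal_lt_top (r := √(4 * Real.pi * w.im)⁻¹))⟩
  rw [hardyENorm_eq]
  refine iSup_le fun y => ?_
  rw [← ofReal_lpNorm (memLp_line_szego w y.2)]
  refine ENNReal.ofReal_le_ofReal (Real.le_sqrt_of_sq_le ?_)
  rw [sq_lpNorm_line_szego w y.2]
  have := w.im_pos
  gcongr
  exact le_add_of_nonneg_right y.2.le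

lemma conj_line_szego (w : ℍ) (hy : 0 < y) (x : ℝ) :
    (starRingEnd ℂ) (line (extend (szego · w)) y x) = -(Complex.I / (2 * Real.pi)) *
      line (fun v => (v - (w + 2 * y * Complex.I))⁻¹) y x := by
  rw [line_szego w hy, Pi.smul_apply]
  simp only [line, smul_eq_mul, map_mul, map_div₀, map_inv₀,
    map_sub, map_add, Complex.conj_I, Complex.conj_ofReal, Complex.conj_conj, map_ofNat]
  ring_nf

lemma im_add_two_mul_pos (w : ℍ) (hy : 0 < y) : 0 < ((w : ℂ) + 2 * y * Complex.I).im := by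
  have him : ((w : ℂ) + 2 * y * Complex.I).im = w.im + 2 * y := by simp
  rw [him]
  exact add_pos w.im_pos (mul_pos two_pos hy)

lemma MemHardy.integral_line_mul_conj_szego_of_eq_zero (hF : MemHardy F) (w : ℍ) (hy : 0 < y)
    (hzero : extend F (w + 2 * y * Complex.I) = 0) :
    ∫ x, line (extend F) y x * (starRingEnd ℂ) (line (extend (szego · w)) y x) = 0 := by
  have hne (x : ℝ) : (x + y * Complex.I : ℂ) ≠ w + 2 * y * Complex.I := by
    intro h
    have him : y = w.im + 2 * y := by simpa using congrArg Complex.im h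
    linarith [w.im_pos]
  calc _ = ∫ x, -(Complex.I / (2 * Real.pi)) *
        line (dslope (extend F) (w + 2 * y * Complex.I)) y x := by
        refine integral_congr_ae (Eventually.of_forall fun x => ?_)
        simp only [conj_line_szego w hy, line_dslope_of_ne hzero (hne x)]
        ring
    _ = 0 := by
        rw [integral_const_mul, hF.integral_line_dslope_eq_zero (im_add_two_mul_pos w hy) hzero hy,
          mul_zero]

lemma extend_szego_add (w : ℍ) (hy : 0 < y) :
    extend (szego · w) (w + 2 * y * Complex.I) = ((4 * Real.pi * (w.im + y))⁻¹ : ℝ) := by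
  have hsum : ((w.im : ℂ) + y) ≠ 0 := by exact_mod_cast (add_pos w.im_pos hy).ne'
  have hsub : (w : ℂ) + 2 * y * Complex.I - (starRingEnd ℂ) (w : ℂ) =
      2 * (w.im + y) * Complex.I := by
    rw [add_sub_right_comm, Complex.sub_conj]
    push_cast
    rw [UpperHalfPlane.coe_im]
    ring
  rw [extend_szego w (im_add_two_mul_pos w hy), hsub]
  push_cast
  field_simp
  norm_num

lemma integral_line_szego_mul_conj (w : ℍ) (hy : 0 < y) :
    ∫ x, line (extend (szego · w)) y x * (starRingEnd ℂ) (line (extend (szego · w)) y x) =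
      extend (szego · w) (w + 2 * y * Complex.I) := by
  rw [extend_szego_add w hy, ← sq_lpNorm_line_szego w hy,
    lpNorm_two_sq (memLp_line_szego w hy).1, ← integral_complex_ofReal]
  simp only [Complex.mul_conj, Complex.normSq_eq_norm_sq]

/-- Subtracting a multiple of the kernel from `F` reduces to a function vanishing at `w + 2iy`. -/
lemma MemHardy.integral_line_mul_conj_szego (hF : MemHardy F) (w : ℍ) (hy : 0 < y) :
    ∫ x, line (extend F) y x * (starRingEnd ℂ) (line (extend (szego · w)) y x) =
      extend F (w + 2 * y * Complex.I) := by
  set c : ℂ := w + 2 * y * Complex.I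
  have hK : extend (szego · w) c ≠ 0 := by
    rw [extend_szego_add w hy, Complex.ofReal_ne_zero]
    have := add_pos w.im_pos hy
    positivity
  set a := extend F c / extend (szego · w) c with ha
  have hG : MemHardy (F - a • (szego · w)) :=
    hardySubmodule.sub_mem hF ((memHardy_szego w).const_smul a)
  have hzero : extend (F - a • (szego · w)) c = 0 := by
    change extend F c - a * extend (szego · w) c = 0
    rw [ha, div_mul_cancel₀ _ hK, sub_self]
  have hint {H : ℍ → ℂ} (hH : MemHardy H) : Integrable fun x =>
      line (extend H) y x * (starRingEnd ℂ) (line (extend (szego · w)) y x) :=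
    (hH.memLp_line hy).integrable_mul (memLp_line_szego w hy).star
  have hsplit (x : ℝ) : line (extend F) y x = line (extend (F - a • (szego · w))) y x +
      a * line (extend (szego · w)) y x :=
    (sub_add_cancel (extend F _) (a * extend (szego · w) _)).symm
  simp only [hsplit, add_mul, mul_assoc]
  rw [integral_add (hint hG) ((hint (memHardy_szego w)).const_mul a), integral_const_mul,
    hG.integral_line_mul_conj_szego_of_eq_zero w hy hzero, integral_line_szego_mul_conj w hy,
    zero_add, ha, div_mul_cancel₀ _ hK]

end SzegoKernel

section HardySpace

/-- The Hardy space `H²(ℂ⁺)` as a type of its own, so that it carries the Hardy norm and not the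
topology of pointwise convergence inherited from `ℍ → ℂ`. -/
def Hardy : Type := hardySubmodule

namespace Hardy

instance : AddCommGroup Hardy := inferInstanceAs (AddCommGroup hardySubmodule)

instance : Module ℂ Hardy := inferInstanceAs (Module ℂ hardySubmodule)

instance : FunLike Hardy ℍ ℂ where
  coe F := F.1
  coe_injective _ _ h := Subtype.ext h

instance : CanLift (ℍ → ℂ) Hardy (fun F => F) MemHardy := ⟨fun F hF => ⟨⟨F, hF⟩, rfl⟩⟩

instance : Norm Hardy := ⟨fun F => hardyNorm F⟩

lemma memHardy (F : Hardy) : MemHardy F := F.2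

lemma norm_eq (F : Hardy) : ‖F‖ = hardyNorm F := rfl

/-- The evaluation of the elements of the Hardy space, as a linear map. -/
def coeHom : Hardy →ₗ[ℂ] ℍ → ℂ := hardySubmodule.subtype

lemma coeHom_apply (F : Hardy) : coeHom F = F := rfl

/-- The restriction of the elements of the Hardy space to the line `Im w = y`. -/
def lineLp (y : Set.Ioi (0 : ℝ)) : Hardy →ₗ[ℂ] Lp ℂ 2 (volume : Measure ℝ) where
  toFun F := (F.memHardy.memLp_line y.2).toLp
  map_add' _ _ := rfl
  map_smul' _ _ := rfl

lemma coeFn_lineLp (y : Set.Ioi (0 : ℝ)) (F : Hardy) : lineLp y F =ᵐ[volume] line (extend F) y :=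
  (F.memHardy.memLp_line y.2).coeFn_toLp

lemma norm_lineLp (y : Set.Ioi (0 : ℝ)) (F : Hardy) :
    ‖lineLp y F‖ = (eLpNorm (line (extend F) y) 2 volume).toReal :=
  Lp.norm_toLp _ (F.memHardy.memLp_line y.2)

lemma norm_lineLp_le (y : Set.Ioi (0 : ℝ)) (F : Hardy) : ‖lineLp y F‖ ≤ ‖F‖ := by
  rw [norm_lineLp, toReal_eLpNorm (F.memHardy.memLp_line y.2).1]
  exact F.memHardy.lpNorm_line_le y.2

lemma tendsto_norm_lineLp (F : Hardy) : Tendsto (fun y => ‖lineLp y F‖) atBot (𝓝 ‖F‖) := by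
  have hanti : Antitone fun y : Set.Ioi (0 : ℝ) => eLpNorm (line (extend F) y) 2 volume := by
    intro a b hab
    simp only [← ofReal_lpNorm (F.memHardy.memLp_line a.2),
      ← ofReal_lpNorm (F.memHardy.memLp_line b.2)]
    exact ENNReal.ofReal_le_ofReal (F.memHardy.lpNorm_line_antitoneOn a.2 b.2 hab)
  have hsup := tendsto_atBot_iSup hanti
  rw [show ⨆ y : Set.Ioi (0 : ℝ), eLpNorm (line (extend F) y) 2 volume = hardyENorm F from
    (hardyENorm_eq F).symm] at hsup
  simp only [norm_lineLp]
  exact (ENNReal.tendsto_toReal F.memHardy.2.ne).comp hsup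

lemma eq_zero_of_lineLp_eq_zero {F : Hardy} (h : ∀ y, lineLp y F = 0) : F = 0 := by
  refine DFunLike.ext _ _ fun w => ?_
  have hline : line (extend F) w.im = 0 :=
    (F.memHardy.continuous_line w.im_pos).ae_eq_iff_eq volume continuous_zero |>.1 <|
      (coeFn_lineLp ⟨w.im, w.im_pos⟩ F).symm.trans <| by
        rw [h]
        exact Lp.coeFn_zero _ _ _
  calc F w = line (extend F) w.im w.re := (line_extend F w.im_pos w.re).symm
    _ = 0 := congrFun hline _

lemma normedSpaceCore : NormedSpace.Core ℂ Hardy where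
  norm_nonneg _ := ENNReal.toReal_nonneg
  norm_smul c F := by
    refine tendsto_nhds_unique (tendsto_norm_lineLp (c • F)) ?_
    simpa only [map_smul, norm_smul] using (tendsto_norm_lineLp F).const_mul ‖c‖
  norm_triangle F G :=
    le_of_tendsto_of_tendsto' (tendsto_norm_lineLp (F + G))
      ((tendsto_norm_lineLp F).add (tendsto_norm_lineLp G)) fun y => by
        rw [map_add]
        exact norm_add_le _ _
  norm_eq_zero_iff F := by
    refine ⟨fun h => eq_zero_of_lineLp_eq_zero fun y => ?_, ?_⟩
    · exact norm_le_zero_iff.1 ((norm_lineLp_le y F).trans_eq h)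
    · rintro rfl
      refine tendsto_nhds_unique (tendsto_norm_lineLp 0) ?_
      simp only [map_zero, norm_zero, tendsto_const_nhds_iff]

instance : NormedAddCommGroup Hardy := NormedAddCommGroup.ofCore normedSpaceCore

instance : NormedSpace ℂ Hardy := NormedSpace.ofCore normedSpaceCore

lemma parallelogram_law (F G : Hardy) :
    ‖F + G‖ * ‖F + G‖ + ‖F - G‖ * ‖F - G‖ = 2 * (‖F‖ * ‖F‖ + ‖G‖ * ‖G‖) := by
  have hsq (H : Hardy) := (tendsto_norm_lineLp H).pow 2
  simp only [← sq]
  refine tendsto_nhds_unique ((hsq (F + G)).add (hsq (F - G))) ?_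
  refine (((hsq F).add (hsq G)).const_mul 2).congr fun y => ?_
  rw [map_add, map_sub]
  exact (parallelogram_law_with_norm ℂ (lineLp y F) (lineLp y G)).symm

instance : InnerProductSpace ℂ Hardy := InnerProductSpace.ofNorm ℂ parallelogram_law

instance : InnerProductSpace ℝ Hardy := InnerProductSpace.complexToReal

lemma tendsto_inner_lineLp (F G : Hardy) :
    Tendsto (fun y => inner ℂ (lineLp y F) (lineLp y G)) atBot (𝓝 (inner ℂ F G)) := by
  have hsq (H : Hardy) : Tendsto (fun y => (‖lineLp y H‖ : ℂ) ^ 2) atBot (𝓝 ((‖H‖ : ℂ) ^ 2)) :=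
    ((Complex.continuous_ofReal.tendsto _).comp (tendsto_norm_lineLp H)).pow 2
  simp only [inner_eq_sum_norm_sq_div_four, ← map_add, ← map_sub, ← map_smul]
  exact (((hsq _).sub (hsq _)).add (((hsq _).sub (hsq _)).mul_const _)).div_const 4

/-- The kernel function `K(·, w)` of the Hardy space. -/
def kernel (w : ℍ) : Hardy := ⟨(szego · w), memHardy_szego w⟩

lemma kernel_apply (w p : ℍ) : kernel w p = szego p w := rfl

lemma inner_lineLp_kernel (y : Set.Ioi (0 : ℝ)) (w : ℍ) (F : Hardy) :
    inner ℂ (lineLp y (kernel w)) (lineLp y F) = extend F (w + 2 * (y : ℝ) * Complex.I) := by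
  rw [L2.inner_def, ← F.memHardy.integral_line_mul_conj_szego w y.2]
  refine integral_congr_ae ?_
  filter_upwards [coeFn_lineLp y F, coeFn_lineLp y (kernel w)] with x hF hK
  rw [hF, hK, RCLike.inner_apply]
  rfl

/-- The reproducing property, as the limit of its version on the line `Im = y`. -/
lemma inner_kernel (w : ℍ) (F : Hardy) : inner ℂ (kernel w) F = F w := by
  refine tendsto_nhds_unique (tendsto_inner_lineLp (kernel w) F) ?_
  simp only [inner_lineLp_kernel]
  refine (tendsto_comp_coe_Ioi_atBot (f := fun y : ℝ => extend F (w + 2 * y * Complex.I))).2 ?_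
  have hcont : ContinuousAt (fun y : ℝ => extend F (w + 2 * y * Complex.I)) 0 := by
    refine ContinuousAt.comp (g := extend F) ?_ (by fun_prop)
    exact (F.memHardy.differentiableAt (by simpa using w.im_pos)).continuousAt
  simpa [extend_coe] using hcont.tendsto.mono_left nhdsWithin_le_nhds

lemma real_inner_kernel (w : ℍ) (F : Hardy) : inner ℝ (kernel w) F = (F w).re := by
  rw [← inner_kernel w F]
  rfl

lemma norm_kernel_sq (w : ℍ) : ‖kernel w‖ ^ 2 = (szego w w).re := by
  rw [← real_inner_self_eq_norm_sq, real_inner_kernel, kernel_apply]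

end Hardy

end HardySpace

section Iteration

variable {N : ℕ} (z : Fin N → ℍ) (A l : Fin N → ℝ) (lam : ℝ)

lemma iterKernel_succ (n : Fin N) : iterKernel z l lam n.succ =
    kernelUpdate (iterKernel z l lam n.castSucc) (z n) (l n) :=
  Fin.induction_succ ..

lemma coefMatrix_succ (n : Fin N) : coefMatrix z l lam n.succ =
    stepMatrix z l (iterKernel z l lam n.castSucc) n * coefMatrix z l lam n.castSucc :=
  Fin.induction_succ ..

lemma stepMatrix_mul_apply (k : ℍ → ℍ → ℂ) (n : Fin N) (M : Matrix (Fin N) (Fin N) ℝ)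
    (i m : Fin N) : (stepMatrix z l k n * M) i m =
      M i m - l n * (k (z n) (z i)).re / (l n * (k (z n) (z n)).re + 1) * M n m := by
  rw [stepMatrix, sub_mul, one_mul, Matrix.sub_apply, Matrix.mul_apply]
  simp [ite_mul]

/-- The element of the Hardy space with coefficients the `i`-th row of `coefMatrix`; its real part
is `Re K_lam^{(n)}(·, z_i)`, while `K_lam^{(n)}(·, z_i)` itself is in general not holomorphic. -/
def iterSolution (n : Fin (N + 1)) (i : Fin N) : Hardy :=
  ∑ m, coefMatrix z l lam n i m • Hardy.kernel (z m)

lemma iterSolution_zero (i : Fin N) :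
    iterSolution z l lam 0 i = (1 / lam) • Hardy.kernel (z i) := by
  have hzero : coefMatrix z l lam 0 = (1 / lam) • 1 := rfl
  simp [iterSolution, hzero, Matrix.one_apply, ite_smul]

lemma iterSolution_succ (n i : Fin N) : iterSolution z l lam n.succ i =
    iterSolution z l lam n.castSucc i -
      (l n * (iterKernel z l lam n.castSucc (z n) (z i)).re /
        (l n * (iterKernel z l lam n.castSucc (z n) (z n)).re + 1)) •
        iterSolution z l lam n.castSucc n := by
  simp only [iterSolution, coefMatrix_succ, stepMatrix_mul_apply, sub_smul,
    Finset.sum_sub_distrib, Finset.smul_sum, smul_smul]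

lemma inner_kernel_iterSolution (n : Fin (N + 1)) (w : ℍ) (i : Fin N) :
    inner ℝ (Hardy.kernel w) (iterSolution z l lam n i) = (iterKernel z l lam n w (z i)).re := by
  induction n using Fin.induction generalizing i with
  | zero =>
    rw [iterSolution_zero, real_inner_smul_right, Hardy.real_inner_kernel, Hardy.kernel_apply]
    exact (Complex.re_ofReal_mul _ _).symm
  | succ n ih =>
    rw [iterSolution_succ, inner_sub_right, real_inner_smul_right, ih, ih, iterKernel_succ,
      kernelUpdate, Complex.sub_re, Complex.ofReal_re, div_mul_eq_mul_div]

variable {lam}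

lemma smul_iterSolution_add_frameOperator {l : Fin N → ℝ} (hl : ∀ j, 0 ≤ l j) (hlam : 0 < lam)
    (n : Fin (N + 1)) (i : Fin N) :
    lam • iterSolution z l lam n i + frameOperator (fun j => Hardy.kernel (z j)) l
      {m | m.castSucc < n} (iterSolution z l lam n i) = Hardy.kernel (z i) := by
  induction n using Fin.induction generalizing i with
  | zero => simp [iterSolution_zero, frameOperator_apply, smul_smul, hlam.ne']
  | succ n ih =>
    have hinsert : Finset.univ.filter (fun m : Fin N => m.castSucc < n.succ) =
        insert n (Finset.univ.filter fun m : Fin N => m.castSucc < n.castSucc) := by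
      ext m
      simp [le_iff_eq_or_lt]
    have hupdate := smul_add_frameOperator_insert hl hlam.le (by simp) (ih i) (ih n)
    rw [hinsert, iterSolution_succ]
    simpa only [inner_kernel_iterSolution] using hupdate

/-- The function `∑ c_j K(·, z_j)` given by the algorithm, as an element of the Hardy space. -/
def approxHardy (z : Fin N → ℍ) (A l : Fin N → ℝ) (lam : ℝ) : Hardy :=
  ∑ j, coef z A l lam j • Hardy.kernel (z j)

lemma coe_approxHardy : ⇑(approxHardy z A l lam) = approxAnalytic z A l lam := by
  rw [← Hardy.coeHom_apply, approxHardy, map_sum]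
  ext w
  simp only [LinearMap.map_smul_of_tower, Finset.sum_apply, Pi.smul_apply, Hardy.coeHom_apply,
    Hardy.kernel_apply, Complex.real_smul, approxAnalytic]

lemma approxHardy_eq_sum_iterSolution :
    approxHardy z A l lam = ∑ i, (l i * A i) • iterSolution z l lam (Fin.last N) i := by
  simp only [approxHardy, coef, Matrix.vecMul, dotProduct, iterSolution, Finset.sum_smul,
    Finset.smul_sum, smul_smul]
  exact Finset.sum_comm

lemma re_approxHardy (w : ℍ) :
    (approxHardy z A l lam w).re = approxSolution z A l lam w := by
  simp only [coe_approxHardy, approxAnalytic, approxSolution, Complex.re_sum,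
    Complex.re_ofReal_mul]

lemma approxSolution_eq_sum (w : ℍ) : approxSolution z A l lam w =
    ∑ j, A j * l j * (iterKernel z l lam (Fin.last N) w (z j)).re := by
  rw [← re_approxHardy, ← Hardy.real_inner_kernel, approxHardy_eq_sum_iterSolution, inner_sum]
  simp only [real_inner_smul_right, inner_kernel_iterSolution, mul_comm (A _)]

lemma smul_approxHardy_add_frameOperator {l : Fin N → ℝ} (hl : ∀ j, 0 ≤ l j) (hlam : 0 < lam) :
    lam • approxHardy z A l lam + frameOperator (fun j => Hardy.kernel (z j)) l Finset.univ
      (approxHardy z A l lam) = ∑ j, (l j * A j) • Hardy.kernel (z j) := by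
  have hnormal (i : Fin N) := smul_iterSolution_add_frameOperator z hl hlam (Fin.last N) i
  simp only [Fin.castSucc_lt_last, Finset.filter_true] at hnormal
  simp only [approxHardy_eq_sum_iterSolution, map_sum, map_smul, Finset.smul_sum,
    ← Finset.sum_add_distrib]
  refine Finset.sum_congr rfl fun i _ => ?_
  rw [smul_comm lam, ← smul_add, hnormal]

end Iteration

section Interpolation

/-- The Blaschke factor `(w - q) / (w - conj q)` of the upper half-plane with zero `q`. -/
def blaschke (q w : ℍ) : ℂ := ((w : ℂ) - q) / ((w : ℂ) - (starRingEnd ℂ) (q : ℂ))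

lemma blaschke_eq_zero_iff {q w : ℍ} : blaschke q w = 0 ↔ w = q := by
  rw [blaschke, div_eq_zero_iff, or_iff_left (sub_conj_ne_zero q w.im_pos), sub_eq_zero,
    UpperHalfPlane.coe_inj]

lemma norm_blaschke_le_one (q w : ℍ) : ‖blaschke q w‖ ≤ 1 := by
  rw [blaschke, norm_div]
  refine div_le_one_of_le₀ (abs_le_of_sq_le_sq' ?_ (norm_nonneg _)).2 (norm_nonneg _)
  simp only [← Complex.normSq_eq_norm_sq, Complex.normSq_apply, Complex.sub_re, Complex.sub_im,
    Complex.conj_re, Complex.conj_im, UpperHalfPlane.coe_im]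
  nlinarith [mul_pos w.im_pos q.im_pos]

lemma MemHardy.blaschke_mul {F : ℍ → ℂ} (hF : MemHardy F) (q : ℍ) :
    MemHardy (blaschke q * F) := by
  refine ⟨?_, (iSup_mono fun y => eLpNorm_mono fun x => ?_).trans_lt hF.2⟩
  · refine DifferentiableOn.congr (f := fun v : ℂ =>
      (v - q) / (v - (starRingEnd ℂ) (q : ℂ)) * extend F v) (fun v hv => ?_) fun v hv => ?_
    · have hne := sub_conj_ne_zero q hv
      have hFv := (hF.differentiableAt hv).differentiableWithinAt (s := {w | 0 < w.im})
      fun_prop (disch := exact hne)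
    · simp only [Pi.mul_apply, blaschke, extend, UpperHalfPlane.ofComplex_apply_of_im_pos hv]
  · rw [Pi.mul_apply, norm_mul]
    exact mul_le_of_le_one_left (norm_nonneg _) (norm_blaschke_le_one q _)

lemma exists_memHardy_apply_ne_zero (p : ℍ) (s : Finset ℍ) (hp : p ∉ s) :
    ∃ F, MemHardy F ∧ F p ≠ 0 ∧ ∀ q ∈ s, F q = 0 := by
  classical
  induction s using Finset.induction with
  | empty =>
    refine ⟨(szego · p), memHardy_szego p, ?_, by simp⟩
    simp [szego, Real.pi_ne_zero, sub_conj_ne_zero p p.im_pos]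
  | insert q s _ ih =>
    rw [Finset.mem_insert, not_or] at hp
    obtain ⟨F, hF, hFp, hFs⟩ := ih hp.2
    refine ⟨blaschke q * F, hF.blaschke_mul q,
      mul_ne_zero (fun h => hp.1 (blaschke_eq_zero_iff.1 h)) hFp, fun r hr => ?_⟩
    rcases Finset.mem_insert.1 hr with rfl | hrs
    · rw [Pi.mul_apply, blaschke_eq_zero_iff.2 rfl, zero_mul]
    · rw [Pi.mul_apply, hFs r hrs, mul_zero]

lemma exists_memHardy_eq_on_finset (s : Finset ℍ) (a : ℍ → ℂ) :
    ∃ F, MemHardy F ∧ ∀ p ∈ s, F p = a p := by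
  classical
  induction s using Finset.induction with
  | empty => exact ⟨0, memHardy_zero, by simp⟩
  | insert p s hp ih =>
    obtain ⟨F, hF, hFs⟩ := ih
    obtain ⟨G, hG, hGp, hGs⟩ := exists_memHardy_apply_ne_zero p s hp
    refine ⟨F + ((a p - F p) / G p) • G, hF.add (hG.const_smul _), fun q hq => ?_⟩
    rw [Pi.add_apply, Pi.smul_apply, smul_eq_mul]
    rcases Finset.mem_insert.1 hq with rfl | hqs
    · rw [div_mul_cancel₀ _ hGp, add_sub_cancel]
    · rw [hGs q hqs, mul_zero, add_zero, hFs q hqs]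

lemma exists_memHardy_re_eq {N : ℕ} {z : Fin N → ℍ} {A : Fin N → ℝ}
    (hA : ∀ i j, z i = z j → A i = A j) : ∃ F, MemHardy F ∧ ∀ j, (F (z j)).re = A j := by
  classical
  have hfactors : A.FactorsThrough z := fun i j => hA i j
  obtain ⟨F, hF, hFz⟩ := exists_memHardy_eq_on_finset (Finset.univ.image z)
    fun p => (Function.extend z A 0 p : ℝ)
  refine ⟨F, hF, fun j => ?_⟩
  rw [hFz (z j) (Finset.mem_image_of_mem z (Finset.mem_univ j)), Complex.ofReal_re,
    hfactors.extend_apply]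

end Interpolation

section ExtremalProblems

variable {N : ℕ} {z : Fin N → ℍ} {A l : Fin N → ℝ} {F : ℍ → ℂ}

lemma forall_memHardy_iff {P : (ℍ → ℂ) → Prop} :
    (∀ G, MemHardy G → P G) ↔ ∀ G : Hardy, P G :=
  ⟨fun h G => h G G.memHardy, fun h G hG => h ⟨G, hG⟩⟩

lemma residual_coe (F : Hardy) :
    residual z A l F = misfit (fun j => Hardy.kernel (z j)) l A F := by
  simp only [residual, misfit, Hardy.real_inner_kernel, sq_abs]

lemma isExtremal_iff (hl : ∀ j, 0 ≤ l j) {lam : ℝ} (hlam : 0 < lam) :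
    IsExtremal z A l lam F ↔ F = approxAnalytic z A l lam := by
  have hHardy (H : Hardy) : IsExtremal z A l lam H ↔ H = approxHardy z A l lam := by
    rw [← regularized_minimizer_iff hl hlam (smul_approxHardy_add_frameOperator z A hl hlam)]
    simp only [IsExtremal, H.memHardy, true_and, forall_memHardy_iff, tikhonov, residual_coe,
      Hardy.norm_eq]
  rw [← coe_approxHardy]
  constructor
  · intro hF
    lift F to Hardy using hF.1
    rw [(hHardy F).1 hF]
  · rintro rfl
    exact (hHardy _).2 rfl

lemma isLeastSquares_coe_iff {H : Hardy} : IsLeastSquares z A l H ↔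
    ∀ G : Hardy, misfit (fun j => Hardy.kernel (z j)) l A H ≤
      misfit (fun j => Hardy.kernel (z j)) l A G := by
  simp only [IsLeastSquares, H.memHardy, true_and, forall_memHardy_iff, residual_coe]

lemma isMoorePenrose_iff (hl : ∀ j, 0 < l j) {u : Hardy}
    (hspan : u ∈ Submodule.span ℝ (Set.range fun j => Hardy.kernel (z j)))
    (hu : frameOperator (fun j => Hardy.kernel (z j)) l Finset.univ u =
      ∑ j, (l j * A j) • Hardy.kernel (z j)) :
    IsMoorePenrose z A l F ↔ F = u := by
  have hHardy (H : Hardy) : IsMoorePenrose z A l H ↔ H = u := by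
    rw [← minimalNorm_minimizer_iff hl hu hspan, IsMoorePenrose, isLeastSquares_coe_iff]
    refine and_congr_right fun _ => ⟨fun h G hG => h G (isLeastSquares_coe_iff.2 hG), ?_⟩
    intro h G hG
    lift G to Hardy using hG.1
    exact h G (isLeastSquares_coe_iff.1 hG)
  constructor
  · intro hF
    lift F to Hardy using hF.1.1
    rw [(hHardy F).1 hF]
  · rintro rfl
    exact (hHardy u).2 rfl

lemma exists_isMoorePenrose_tendsto (z : Fin N → ℍ) (A : Fin N → ℝ) (hl : ∀ j, 0 < l j) :
    ∃ u : Hardy, (∀ F, IsMoorePenrose z A l F ↔ F = u) ∧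
      Tendsto (approxHardy z A l) (𝓝[>] 0) (𝓝 u) := by
  obtain ⟨u, hspan, hu⟩ := exists_frameOperator_eq (v := fun j => Hardy.kernel (z j)) hl
    (Submodule.sum_mem _ fun j _ =>
      Submodule.smul_mem _ (l j * A j) (Submodule.subset_span (Set.mem_range_self j)))
  refine ⟨u, fun F => isMoorePenrose_iff hl hspan hu, tendsto_of_regularized hl hspan ?_⟩
  intro lam hlam
  rw [hu, smul_approxHardy_add_frameOperator z A (fun j => (hl j).le) hlam]

lemma IsLeastSquares.re_eq (hF : IsLeastSquares z A l F) (hl : ∀ j, 0 < l j)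
    (hA : ∀ i j, z i = z j → A i = A j) (j : Fin N) : (F (z j)).re = A j := by
  obtain ⟨G, hG, hGz⟩ := exists_memHardy_re_eq hA
  lift F to Hardy using hF.1
  lift G to Hardy using hG
  simp only [← Hardy.real_inner_kernel] at hGz ⊢
  have hzero := (misfit_eq_zero_iff hl).2 hGz
  have hle := (isLeastSquares_coe_iff.1 hF G).trans_eq hzero
  exact (misfit_eq_zero_iff hl).1 (hle.antisymm (misfit_nonneg (fun j => (hl j).le) _)) j

end ExtremalProblems

section Convergence

lemma Hardy.abs_re_sub_le (F G : Hardy) (w : ℍ) :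
    |(F w).re - (G w).re| ≤ √(szego w w).re * ‖F - G‖ := by
  rw [← Hardy.real_inner_kernel, ← Hardy.real_inner_kernel, ← inner_sub_right,
    ← Hardy.norm_kernel_sq, Real.sqrt_sq (norm_nonneg _)]
  exact abs_real_inner_le_norm _ _

lemma Hardy.tendstoUniformlyOn_re {ι : Type*} {p : Filter ι} {f : ι → Hardy} {F : Hardy}
    (hf : Tendsto f p (𝓝 F)) {E : Set ℍ}
    (hE : BddAbove ((fun w : ℍ => (szego w w).re) '' E)) :
    TendstoUniformlyOn (fun i w => (f i w).re) (fun w => (F w).re) p E := by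
  obtain ⟨C, hC⟩ := hE
  have hlim : Tendsto (fun i => √C * ‖f i - F‖) p (𝓝 0) := by
    simpa using (tendsto_iff_norm_sub_tendsto_zero.1 hf).const_mul √C
  refine Metric.tendstoUniformlyOn_iff.2 fun ε hε => ?_
  filter_upwards [hlim.eventually_lt_const hε] with i hi w hw
  calc dist (F w).re (f i w).re = |(f i w).re - (F w).re| := by rw [dist_comm, Real.dist_eq]
    _ ≤ √(szego w w).re * ‖f i - F‖ := Hardy.abs_re_sub_le _ _ _
    _ ≤ √C * ‖f i - F‖ := by gcongr; exact hC ⟨w, hw, rfl⟩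
    _ < ε := hi

lemma Hardy.tendsto_re {ι : Type*} {p : Filter ι} {f : ι → Hardy} {F : Hardy}
    (hf : Tendsto f p (𝓝 F)) (w : ℍ) : Tendsto (fun i => (f i w).re) p (𝓝 (F w).re) := by
  simp only [← Hardy.real_inner_kernel]
  exact tendsto_const_nhds.inner hf

lemma MemHardy.harmonicOnNhd_re {F : ℍ → ℂ} (hF : MemHardy F) :
    InnerProductSpace.HarmonicOnNhd (fun w : ℂ => (extend F w).re) {w | 0 < w.im} := fun _ hw =>
  AnalyticAt.harmonicAt_re
    (hF.1.analyticAt (UpperHalfPlane.isOpen_upperHalfPlaneSet.mem_nhds hw))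

end Convergence

end HardyDirichlet

end

theorem theorem2 {N : ℕ} (z : Fin N → ℍ) (A l : Fin N → ℝ) (hl : ∀ j, 0 < l j) :
    -- the function given by the algorithm solves the regularized extremal problem
    (∀ lam : ℝ, 0 < lam →
      (∀ w : ℍ, HardyDirichlet.approxSolution z A l lam w =
        ∑ j, A j * l j * (HardyDirichlet.iterKernel z l lam (Fin.last N) w (z j)).re) ∧
      ∃ F : ℍ → ℂ, HardyDirichlet.IsExtremal z A l lam F ∧
        (∀ G : ℍ → ℂ, HardyDirichlet.IsExtremal z A l lam G → G = F) ∧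
        (∀ w : ℍ, (F w).re = HardyDirichlet.approxSolution z A l lam w) ∧
        F = HardyDirichlet.approxAnalytic z A l lam) ∧
    -- as `lam → 0`, it converges to the Moore–Penrose solution
    ∃ F : ℍ → ℂ, HardyDirichlet.IsMoorePenrose z A l F ∧
      (∀ G : ℍ → ℂ, HardyDirichlet.IsMoorePenrose z A l G → G = F) ∧
      (∀ w : ℍ, Tendsto (fun lam : ℝ => HardyDirichlet.approxSolution z A l lam w)
        (𝓝[>] 0) (𝓝 (F w).re)) ∧
      (∀ E : Set ℍ, BddAbove ((fun p : ℍ => (HardyDirichlet.szego p p).re) '' E) →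
        TendstoUniformlyOn (fun lam : ℝ => HardyDirichlet.approxSolution z A l lam)
          (fun w : ℍ => (F w).re) (𝓝[>] 0) E) ∧
      Tendsto (fun lam : ℝ => HardyDirichlet.hardyNorm
        (HardyDirichlet.approxAnalytic z A l lam - F)) (𝓝[>] 0) (𝓝 0) ∧
      -- whose real part solves the discrete Dirichlet problem
      InnerProductSpace.HarmonicOnNhd
        (fun w : ℂ => (F (UpperHalfPlane.ofComplex w)).re) {w : ℂ | 0 < w.im} ∧
      ((∀ i j, z i = z j → A i = A j) → ∀ j, (F (z j)).re = A j) := by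
  open HardyDirichlet in
  obtain ⟨u, hmoore, hlim⟩ := exists_isMoorePenrose_tendsto z A hl
  have hre (lam : ℝ) : approxSolution z A l lam = fun w => (approxHardy z A l lam w).re :=
    funext fun w => (re_approxHardy z A l w).symm
  have hleast : IsLeastSquares z A l u := ((hmoore u).2 rfl).1
  refine ⟨fun lam hlam => ⟨approxSolution_eq_sum z A l, approxAnalytic z A l lam, ?_⟩,
    u, (hmoore u).2 rfl, fun G => (hmoore G).1, fun w => ?_, fun E hE => ?_, ?_,
    u.memHardy.harmonicOnNhd_re, hleast.re_eq hl⟩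
  · have hextremal {G} : IsExtremal z A l lam G ↔ G = approxAnalytic z A l lam :=
      isExtremal_iff (fun j => (hl j).le) hlam
    refine ⟨hextremal.2 rfl, fun G => hextremal.1, fun w => ?_, rfl⟩
    rw [← coe_approxHardy, re_approxHardy]
  · simpa only [hre] using Hardy.tendsto_re hlim w
  · simpa only [hre] using Hardy.tendstoUniformlyOn_re hlim hE
  · simp only [← coe_approxHardy]
    exact tendsto_iff_norm_sub_tendsto_zero.1 hlim
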